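/- Let $g:\mathbb{N}\to\mathbb{R}$ be strongly additive, that is, $g(p^k)=g(p)$ for all primes $p$ and integers $k\ge 1$, and $g(mn)=g(m)+g(n)$ whenever $\gcd(m,n)=1$. Let $V(n)$ be a uniformly distributed random integer in $\{1,\dots,n\}$ and let $X(n)=g(V(n))$. A sequence $(P_n)$ of probability measures on $\mathbb{R}$ is said to satisfy the large deviation principle (LDP) with speed $b_n$ and rate function $I:\mathbb{R}\to[0,+\infty]$ if $I$ is lower semicontinuous and, for every Borel set $A\subseteq\mathbb{R}$, $$-\inf_{x\in A^{\circ}}I(x)\le\liminf_{n\to\infty}\frac1{b_n}\log P_n(A)\le\limsup_{n\to\infty}\frac1{b_n}\log P_n(A)\le-\inf_{x\in\overline{A}}I(x),$$ where $A^\circ$ and $\overline A$ are the interior and closure of $A$, $\log 0=-\infty$ and $\inf\emptyset=+\infty$. Suppose that $g(p)\to\lambda\in(0,\infty)$ as $p\to\infty$ along the primes. Then the laws of $X(n)/\log\log n$ satisfy the LDP with speed $\log\log n$ and rate function $$I(x)=\begin{cases}\dfrac{x}{\lambda}\log\dfrac{x}{\lambda}-\dfrac{x}{\lambda}+1,& x\ge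 0,\\ +\infty,& x<0,\end{cases}$$ with the convention $0\log 0=0$. In particular, if $g(p)=1$ for all primes $p$, then $g(m)=\omega(m)$, the number of distinct prime factors of $m$, for all $m\ge 1$, and the laws of $X(n)/\log\log n=\omega(V(n))/\log\log n$ satisfy the LDP with speed $\log\log n$ and rate function $I(x)=x\log x-x+1$ for $x\ge 0$ (with $0\log 0=0$) and $I(x)=+\infty$ for $x<0$. -/

import Mathlib

open Filter Topology MeasureTheory

/-- `g` is strongly additive: `g (p ^ k) = g p` for primes `p` and `k ≥ 1`, and
`g (m * n) = g m + g n` for coprime `m`, `n`. The value `g 0` is irrelevant. -/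
structure IsStronglyAdditive (g : ℕ → ℝ) : Prop where
  map_prime_pow : ∀ p k : ℕ, p.Prime → 1 ≤ k → g (p ^ k) = g p
  map_mul : ∀ m n : ℕ, m.Coprime n → g (m * n) = g m + g n

/-- The sequence of probability measures `P n` satisfies the large deviation principle with speed
`b n` and rate function `I`. Logarithms, infima and limits are taken in the extended reals
(`log 0 = -∞`, the infimum over the empty set is `+∞`). As only the behaviour as `n → ∞` matters,
finitely many `P n` may fail to be probability measures. -/
structure SatisfiesLDP {E : Type*} [TopologicalSpace E] [MeasurableSpace E]
    (P : ℕ → Measure E) (b : ℕ → ℝ) (I : E → EReal) : Prop where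
  isProbabilityMeasure : ∀ᶠ n in atTop, IsProbabilityMeasure (P n)
  nonneg : ∀ x, 0 ≤ I x
  lowerSemicontinuous : LowerSemicontinuous I
  lower_bound : ∀ A : Set E, MeasurableSet A →
    -(⨅ x ∈ interior A, I x) ≤
      liminf (fun n => (((b n)⁻¹ : ℝ) : EReal) * ENNReal.log (P n A)) atTop
  upper_bound : ∀ A : Set E, MeasurableSet A →
    limsup (fun n => (((b n)⁻¹ : ℝ) : EReal) * ENNReal.log (P n A)) atTop ≤
      -(⨅ x ∈ closure A, I x)

/-- The law of `X(n) / log log n`, where `X(n) = g (V(n))` and `V(n)` is uniformly distributed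
on `{1, …, n}`. -/
noncomputable def scaledLaw (g : ℕ → ℝ) (n : ℕ) : Measure ℝ :=
  (ProbabilityTheory.uniformOn (Set.Icc 1 n)).map
    (fun v : ℕ => g v / Real.log (Real.log (n : ℝ)))

/-- `(x/λ) log (x/λ) - x/λ + 1` for `x ≥ 0` (with `0 log 0 = 0`), and `+∞` for `x < 0`. -/
noncomputable def poissonRate (lam : ℝ) (x : ℝ) : EReal :=
  if 0 ≤ x then ((x / lam * Real.log (x / lam) - x / lam + 1 : ℝ) : EReal) else ⊤

/-- `x log x - x + 1` for `x ≥ 0` (with `0 log 0 = 0`), and `+∞` for `x < 0`. -/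
noncomputable def standardPoissonRate (x : ℝ) : EReal :=
  if 0 ≤ x then ((x * Real.log x - x + 1 : ℝ) : EReal) else ⊤

/-! The proof is a Gärtner–Ellis argument. Write L = log log n. Everything rests on showing that the
mean of exp(θ g(m)) over m ≤ n is (log n)^(exp(θλ) - 1 + o(1)) for every real θ, as for λ times a
Poisson variable of mean L; the rate function is the Legendre transform of exp(θλ) - 1.

A strongly additive g is the sum of g(p) over the primes p dividing m, so exp(θ g) is a product over
those primes. Expanding it over squarefree divisors and replacing each ⌊n/d⌋ by n/d predicts the
mean ∏ (1 + (exp(θ g(p)) - 1)/p), which the estimate ∑ 1/p ~ log log x turns into the power of log n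
above. The replacement is legitimate for primes up to y = n^(1/L²), by Rankin's trick
(`abs_sum_prod_filter_dvd_sub_le`). Since log log y = L - 2 log L, the primes between y and n carry
only o(L) of the sum of reciprocals.

These large primes are then restored. Their contribution to g is nonnegative for large n, which
gives the lower bound for θ ≥ 0 and the upper bound for θ ≤ 0. For θ ≥ 0 the upper bound follows
from ⌊n/d⌋ ≤ n/d alone (`eventually_mgf_le`). For θ ≤ 0 the lower bound needs the integers whose
large primes contribute more than εL to be negligible, which a joint exponential moment shows
(`eventually_le_mgf`).

Finally, exponential Markov bounds give the upper half of the large deviation principle, and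
exponential tilting gives the lower half (`HasPoissonExpMoments.satisfiesLDP`). -/

/-! ### Sums of reciprocals of primes. -/

/-- The completely multiplicative function `n ↦ n ^ (-s)`. -/
noncomputable def natRpowNegHom (s : ℝ) : ℕ →* ℝ where
  toFun n := (n : ℝ) ^ (-s)
  map_one' := by simp
  map_mul' m n := by
    rw [Nat.cast_mul, Real.mul_rpow (Nat.cast_nonneg m) (Nat.cast_nonneg n)]

theorem natRpowNegHom_apply (s : ℝ) (n : ℕ) : natRpowNegHom s n = (n : ℝ) ^ (-s) := rfl

theorem natRpowNegHom_nonneg (s : ℝ) (n : ℕ) : 0 ≤ natRpowNegHom s n := by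
  rw [natRpowNegHom_apply]; positivity

theorem natRpowNegHom_lt_one {s : ℝ} (hs : 0 < s) {p : ℕ} (hp : p.Prime) :
    natRpowNegHom s p < 1 :=
  Real.rpow_lt_one_of_one_lt_of_neg (by exact_mod_cast hp.one_lt) (by linarith)

theorem norm_natRpowNegHom_lt_one {s : ℝ} (hs : 0 < s) {p : ℕ} (hp : p.Prime) :
    ‖natRpowNegHom s p‖ < 1 := by
  rw [Real.norm_of_nonneg (natRpowNegHom_nonneg s p)]
  exact natRpowNegHom_lt_one hs hp

theorem sum_inv_sub_one_sub_inv_le (N : ℕ) :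
    ∑ p ∈ Nat.primesLE N, (1 / ((p : ℝ) - 1) - 1 / (p : ℝ)) ≤ 1 := by
  have hsub : Nat.primesLE N ⊆ Finset.Ico 2 (N + 2) := by
    intro p hp
    rw [Nat.primesLE, Nat.mem_primesBelow] at hp
    have := hp.2.two_le
    simp only [Finset.mem_Ico]; omega
  calc ∑ p ∈ Nat.primesLE N, (1 / ((p : ℝ) - 1) - 1 / (p : ℝ))
      ≤ ∑ p ∈ Finset.Ico 2 (N + 2), (1 / ((p : ℝ) - 1) - 1 / (p : ℝ)) := by
        refine Finset.sum_le_sum_of_subset_of_nonneg hsub fun p hp _ => ?_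
        have h2 : (2 : ℝ) ≤ p := by exact_mod_cast (Finset.mem_Ico.1 hp).1
        have : 1 / (p : ℝ) ≤ 1 / ((p : ℝ) - 1) :=
          one_div_le_one_div_of_le (by linarith) (by linarith)
        linarith
    _ = ∑ k ∈ Finset.range N, (1 / ((k : ℝ) + 1) - 1 / (((k + 1 : ℕ) : ℝ) + 1)) := by
        rw [Finset.sum_Ico_eq_sum_range]
        refine Finset.sum_congr (by simp) fun k _ => ?_
        push_cast
        congr 2 <;> ring
    _ = 1 - 1 / ((N : ℝ) + 1) := by
        rw [Finset.sum_range_sub' (fun k : ℕ => 1 / ((k : ℝ) + 1))]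
        simp
    _ ≤ 1 := by
        have : 0 ≤ 1 / ((N : ℝ) + 1) := by positivity
        linarith

/-- Every m ≤ N has all its prime factors at most N, so 1/m occurs in the expanded Euler product. -/
theorem harmonic_le_prod_primesLE (N : ℕ) :
    (harmonic N : ℝ) ≤ ∏ p ∈ Nat.primesLE N, (1 - natRpowNegHom 1 p)⁻¹ := by
  have h := (EulerProduct.summable_and_hasSum_smoothNumbers_prod_primesBelow_geometric
    (f := natRpowNegHom 1) (norm_natRpowNegHom_lt_one one_pos) (N + 1)).2
  have h' := (hasSum_subtype_iff_indicator (f := natRpowNegHom 1)).1 h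
  have := sum_le_hasSum (Finset.Icc 1 N)
    (fun i _ => Set.indicator_nonneg (fun n _ => natRpowNegHom_nonneg 1 n) i) h'
  refine le_trans (le_of_eq ?_) this
  rw [harmonic_eq_sum_Icc]
  push_cast
  refine Finset.sum_congr rfl fun m hm => ?_
  rw [Finset.mem_Icc] at hm
  rw [Set.indicator_of_mem (Nat.mem_smoothNumbers_of_lt (by omega) (by omega)),
    natRpowNegHom_apply, Real.rpow_neg_one]

theorem log_log_le_sum_primesLE {x : ℝ} (hx : 1 < x) :
    Real.log (Real.log x) ≤ ∑ p ∈ Nat.primesLE ⌊x⌋₊, 1 / (p : ℝ) + 1 := by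
  rw [Real.log_le_iff_le_exp (Real.log_pos hx)]
  calc Real.log x ≤ harmonic ⌊x⌋₊ := log_le_harmonic_floor x (by linarith)
    _ ≤ ∏ p ∈ Nat.primesLE ⌊x⌋₊, (1 - natRpowNegHom 1 p)⁻¹ := harmonic_le_prod_primesLE _
    _ ≤ ∏ p ∈ Nat.primesLE ⌊x⌋₊, Real.exp (1 / ((p : ℝ) - 1)) := by
        refine Finset.prod_le_prod (fun p hp => ?_) fun p hp => ?_ <;>
          have hp' := (Nat.mem_primesBelow.1 hp).2
        · exact inv_nonneg.2 (sub_nonneg.2 (natRpowNegHom_lt_one one_pos hp').le)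
        · have h2 : (2 : ℝ) ≤ p := by exact_mod_cast hp'.two_le
          have : (1 - natRpowNegHom 1 p)⁻¹ = 1 / ((p : ℝ) - 1) + 1 := by
            rw [natRpowNegHom_apply, Real.rpow_neg_one]
            have : (p : ℝ) - 1 ≠ 0 := by linarith
            field_simp
            ring
          rw [this]
          exact Real.add_one_le_exp _
    _ = Real.exp (∑ p ∈ Nat.primesLE ⌊x⌋₊, 1 / ((p : ℝ) - 1)) := (Real.exp_sum _ _).symm
    _ ≤ _ := by
        refine Real.exp_le_exp.2 ?_
        have := sum_inv_sub_one_sub_inv_le ⌊x⌋₊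
        rw [Finset.sum_sub_distrib] at this
        linarith

theorem sum_primesLE_rpow_le (N : ℕ) {s : ℝ} (hs : 1 < s) :
    ∑ p ∈ Nat.primesLE N, (p : ℝ) ^ (-s) ≤ Real.log (∑' n : ℕ, 1 / (n : ℝ) ^ s) := by
  have h := (EulerProduct.summable_and_hasSum_smoothNumbers_prod_primesBelow_geometric
    (f := natRpowNegHom s) (norm_natRpowNegHom_lt_one (by linarith)) (N + 1)).2
  have heq : ∀ n : ℕ, 1 / (n : ℝ) ^ s = natRpowNegHom s n := fun n => by
    rw [natRpowNegHom_apply, Real.rpow_neg (Nat.cast_nonneg n), one_div]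
  have hsum : Summable fun n : ℕ => natRpowNegHom s n := by
    simp_rw [← heq]; exact Real.summable_one_div_nat_rpow.2 hs
  have hle : ∏ p ∈ Nat.primesLE N, (1 - natRpowNegHom s p)⁻¹ ≤ ∑' n : ℕ, 1 / (n : ℝ) ^ s := by
    simp_rw [heq]
    rw [Nat.primesLE, ← h.tsum_eq]
    exact hsum.tsum_subtype_le _ _ (natRpowNegHom_nonneg s)
  have hexp : Real.exp (∑ p ∈ Nat.primesLE N, (p : ℝ) ^ (-s)) ≤
      ∏ p ∈ Nat.primesLE N, (1 - natRpowNegHom s p)⁻¹ := by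
    rw [Real.exp_sum]
    refine Finset.prod_le_prod (fun p _ => (Real.exp_pos _).le) fun p hp => ?_
    have hlt := natRpowNegHom_lt_one (s := s) (by linarith) (Nat.mem_primesBelow.1 hp).2
    rw [natRpowNegHom_apply] at hlt ⊢
    rw [le_inv_comm₀ (Real.exp_pos _) (by linarith), ← Real.exp_neg]
    linarith [Real.add_one_le_exp (-(p : ℝ) ^ (-s))]
  exact (Real.le_log_iff_exp_le ((Real.exp_pos _).trans_le (hexp.trans hle))).2 (hexp.trans hle)

/-- With s = 1 + δ / log x, each prime p ≤ x satisfies p^(s-1) ≤ exp δ, so 1/p may be replaced by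
p^(-s) at the cost of a constant factor. The Euler product and the simple pole of zeta at 1 then
bound the sum. -/
theorem eventually_sum_primesLE_le {δ : ℝ} (hδ : 0 < δ) :
    ∀ᶠ x : ℝ in atTop, ∑ p ∈ Nat.primesLE ⌊x⌋₊, 1 / (p : ℝ) ≤
      Real.exp δ * (Real.log (Real.log x) + Real.log (2 / δ)) := by
  have hzeta : ∀ᶠ s : ℝ in 𝓝[>] 1, (s - 1) * ∑' n : ℕ, 1 / (n : ℝ) ^ s < 2 :=
    tendsto_sub_mul_tsum_nat_rpow.eventually_lt_const one_lt_two
  have hlog : Tendsto (fun x : ℝ => 1 + δ / Real.log x) atTop (𝓝[>] 1) := by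
    refine tendsto_nhdsWithin_iff.2 ⟨?_, ?_⟩
    · simpa using (Real.tendsto_log_atTop.const_div_atTop δ).const_add 1
    · filter_upwards [eventually_gt_atTop 1] with x hx
      have := div_pos hδ (Real.log_pos hx)
      simpa using this
  filter_upwards [hlog.eventually hzeta, eventually_gt_atTop 1] with x hx hx1
  have hL := Real.log_pos hx1
  set s := 1 + δ / Real.log x with hs
  have hs1 : 0 < s - 1 := by rw [hs]; simpa using div_pos hδ hL
  have h1 : ∀ p ∈ Nat.primesLE ⌊x⌋₊, 1 / (p : ℝ) ≤ Real.exp δ * (p : ℝ) ^ (-s) := by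
    intro p hp
    obtain ⟨hpx, hpp⟩ := Nat.mem_primesBelow.1 hp
    have hp0 : (0 : ℝ) < p := by exact_mod_cast hpp.pos
    have hple : (p : ℝ) ≤ x :=
      (Nat.le_floor_iff (by linarith)).1 (Nat.lt_succ_iff.1 hpx)
    have hpl : Real.log p ≤ Real.log x := Real.log_le_log hp0 hple
    rw [one_div, ← Real.exp_log (inv_pos.2 hp0), Real.log_inv, Real.rpow_def_of_pos hp0,
      ← Real.exp_add]
    refine Real.exp_le_exp.2 ?_
    have : δ / Real.log x * Real.log p ≤ δ := by
      rw [div_mul_eq_mul_div, div_le_iff₀ hL]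
      exact mul_le_mul_of_nonneg_left hpl hδ.le
    rw [hs]; linarith
  have hz : Real.log (∑' n : ℕ, 1 / (n : ℝ) ^ s) ≤
      Real.log (Real.log x) + Real.log (2 / δ) := by
    have hpos : 0 < ∑' n : ℕ, 1 / (n : ℝ) ^ s :=
      (Real.summable_one_div_nat_rpow.2 (by linarith)).tsum_pos (fun n => by positivity) 1 (by simp)
    rw [← Real.log_mul hL.ne' (by positivity)]
    refine Real.log_le_log hpos ?_
    have : ∑' n : ℕ, 1 / (n : ℝ) ^ s ≤ 2 / (s - 1) := by
      rw [le_div_iff₀ hs1, mul_comm]; exact hx.le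
    refine this.trans (le_of_eq ?_)
    rw [hs, add_sub_cancel_left]; field_simp
  calc _ ≤ ∑ p ∈ Nat.primesLE ⌊x⌋₊, Real.exp δ * (p : ℝ) ^ (-s) := Finset.sum_le_sum h1
    _ = Real.exp δ * ∑ p ∈ Nat.primesLE ⌊x⌋₊, (p : ℝ) ^ (-s) := (Finset.mul_sum _ _ _).symm
    _ ≤ _ := mul_le_mul_of_nonneg_left
        ((sum_primesLE_rpow_le _ (by linarith)).trans hz) (Real.exp_pos _).le

theorem tendsto_log_log_atTop : Tendsto (fun x : ℝ => Real.log (Real.log x)) atTop atTop :=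
  Real.tendsto_log_atTop.comp Real.tendsto_log_atTop

/-- The sum of the reciprocals of the primes up to `x` is asymptotic to `log log x`. -/
theorem tendsto_sum_primesLE_div_log_log :
    Tendsto (fun x : ℝ => (∑ p ∈ Nat.primesLE ⌊x⌋₊, 1 / (p : ℝ)) / Real.log (Real.log x))
      atTop (𝓝 1) := by
  have hlim : ∀ c : ℝ, Tendsto (fun x : ℝ => 1 + c / Real.log (Real.log x)) atTop (𝓝 1) := by
    intro c
    simpa using (tendsto_log_log_atTop.const_div_atTop c).const_add 1
  rw [tendsto_order]
  constructor
  · intro a ha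
    filter_upwards [(hlim (-1)).eventually_const_lt ha, eventually_gt_atTop 1,
      tendsto_log_log_atTop.eventually_gt_atTop 0] with x h1 h2 h3
    refine h1.trans_le ?_
    rw [le_div_iff₀ h3, add_mul, div_mul_cancel₀ _ h3.ne']
    linarith [log_log_le_sum_primesLE h2]
  · intro a ha
    have hexp : Tendsto Real.exp (𝓝[>] 0) (𝓝 1) := by
      simpa using (Real.continuous_exp.tendsto 0).mono_left nhdsWithin_le_nhds
    obtain ⟨δ, hδa, hδ⟩ := ((hexp.eventually_lt_const ha).and self_mem_nhdsWithin).exists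
    have hl : Tendsto (fun x : ℝ => Real.exp δ * (1 + Real.log (2 / δ) / Real.log (Real.log x)))
        atTop (𝓝 (Real.exp δ)) := by
      simpa using (hlim (Real.log (2 / δ))).const_mul (Real.exp δ)
    filter_upwards [hl.eventually_lt_const hδa, eventually_sum_primesLE_le hδ,
      tendsto_log_log_atTop.eventually_gt_atTop 0] with x h1 h2 h3
    refine lt_of_le_of_lt ?_ h1
    rw [div_le_iff₀ h3, mul_assoc, add_mul, div_mul_cancel₀ _ h3.ne', one_mul]
    exact h2

/-- If `c p → a` along the primes, then `∑_{p ≤ x} c p / p` is asymptotically `a log log x`. -/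
theorem tendsto_sum_primesLE_mul_div_log_log {c : ℕ → ℝ} {a : ℝ}
    (hc : Tendsto c (atTop ⊓ 𝓟 {p : ℕ | p.Prime}) (𝓝 a)) :
    Tendsto (fun x : ℝ => (∑ p ∈ Nat.primesLE ⌊x⌋₊, c p / (p : ℝ)) / Real.log (Real.log x))
      atTop (𝓝 a) := by
  set w : ℕ → ℝ := fun p => if p.Prime then 1 / (p : ℝ) else 0 with hw
  set v : ℕ → ℝ := fun p => if p.Prime then (c p - a) / (p : ℝ) else 0 with hv
  have hsum : ∀ (d : ℕ → ℝ) (N : ℕ), ∑ p ∈ Nat.primesLE N, d p =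
      ∑ p ∈ Finset.range (N + 1), if p.Prime then d p else 0 := fun d N => by
    rw [Nat.primesLE_eq_filter_range, Finset.sum_filter]
  have hw0 : 0 ≤ w := fun p => by
    simp only [hw, Pi.zero_apply]; split_ifs <;> positivity
  have hvw : v =o[atTop] w := by
    rw [Asymptotics.isLittleO_iff]
    intro ε hε
    have h := eventually_inf_principal.1 (hc.eventually (Metric.ball_mem_nhds a hε))
    filter_upwards [h] with p hp
    simp only [hv, hw]
    split_ifs with hpp
    · have := hp hpp
      replace : |c p - a| < ε := by rwa [← Real.dist_eq]
      rw [norm_div, norm_div, norm_one, mul_one_div, Real.norm_eq_abs (c p - a)]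
      exact div_le_div_of_nonneg_right this.le (norm_nonneg _)
    · simp
  have hM := tendsto_sum_primesLE_div_log_log
  have hMtop : Tendsto (fun x : ℝ => ∑ p ∈ Nat.primesLE ⌊x⌋₊, 1 / (p : ℝ)) atTop atTop := by
    refine tendsto_atTop_mono' atTop ?_ (tendsto_atTop_add_const_right _ (-1) tendsto_log_log_atTop)
    filter_upwards [eventually_gt_atTop 1] with x hx
    linarith [log_log_le_sum_primesLE hx]
  -- Divergence of the weights is what lets the termwise relation `v = o(w)` pass to partial sums.
  have hwtop : Tendsto (fun n => ∑ i ∈ Finset.range n, w i) atTop atTop := by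
    rw [← tendsto_add_atTop_iff_nat 1]
    refine (hMtop.comp tendsto_natCast_atTop_atTop).congr fun n => ?_
    simp [hw, hsum]
  have hlo := (hvw.sum_range hw0 hwtop).comp_tendsto
    ((tendsto_add_atTop_nat 1).comp (tendsto_nat_floor_atTop (α := ℝ)))
  have h0 := hlo.tendsto_div_nhds_zero
  have h1 := (h0.mul hM).add (hM.const_mul a)
  rw [zero_mul, mul_one, zero_add] at h1
  refine h1.congr' ?_
  filter_upwards [hMtop.eventually_gt_atTop 0] with x hx
  simp only [Function.comp_apply]
  rw [← hsum, ← hsum, div_mul_div_cancel₀ hx.ne', ← mul_div_assoc, ← add_div]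
  congr 1
  rw [Finset.mul_sum, ← Finset.sum_add_distrib]
  refine Finset.sum_congr rfl fun p _ => ?_
  ring

/-! ### Sieve estimates for products over prime divisors. -/

/-- For a finite set `Q` of primes, the sum over `1 ≤ m ≤ n` of the product of `f p` over the
`p ∈ Q` dividing `m`. -/
theorem sum_prod_filter_dvd (Q : Finset ℕ) (hQ : ∀ p ∈ Q, p.Prime) (f : ℕ → ℝ) (n : ℕ) :
    ∑ m ∈ Finset.Icc 1 n, ∏ p ∈ Q with p ∣ m, f p =
      ∑ S ∈ Q.powerset, (∏ p ∈ S, (f p - 1)) * ((n / ∏ p ∈ S, p : ℕ) : ℝ) := by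
  classical
  have h1 : ∀ m : ℕ, ∏ p ∈ Q with p ∣ m, f p =
      ∑ S ∈ Q.powerset, if (∏ p ∈ S, p) ∣ m then ∏ p ∈ S, (f p - 1) else 0 := by
    intro m
    rw [← Finset.sum_filter]
    have : ∏ p ∈ Q with p ∣ m, f p = ∏ p ∈ Q with p ∣ m, (1 + (f p - 1)) :=
      Finset.prod_congr rfl fun p _ => by ring
    rw [this, Finset.prod_one_add]
    refine Finset.sum_congr ?_ fun _ _ => rfl
    ext S
    rw [Finset.mem_powerset, Finset.mem_filter, Finset.mem_powerset]
    constructor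
    · intro hS
      have hS' := fun p (hp : p ∈ S) => Finset.mem_filter.1 (hS hp)
      exact ⟨fun p hp => (hS' p hp).1, Finset.prod_primes_dvd m
        (fun p hp => (hQ p (hS' p hp).1).prime) fun p hp => (hS' p hp).2⟩
    · rintro ⟨hS, hdvd⟩ p hp
      exact Finset.mem_filter.2 ⟨hS hp, (Finset.dvd_prod_of_mem _ hp).trans hdvd⟩
  simp_rw [h1]
  rw [Finset.sum_comm]
  refine Finset.sum_congr rfl fun S _ => ?_
  rw [← Finset.sum_filter, Finset.sum_const, nsmul_eq_mul, mul_comm]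
  congr 2
  exact Nat.Ioc_filter_dvd_card_eq_div n _

theorem prod_one_add_div_eq_sum_powerset (Q : Finset ℕ) (h : ℕ → ℝ) (n : ℝ) :
    n * ∏ p ∈ Q, (1 + h p / p) =
      ∑ S ∈ Q.powerset, (∏ p ∈ S, h p) * (n / ((∏ p ∈ S, p : ℕ) : ℝ)) := by
  rw [Finset.prod_one_add, Finset.mul_sum]
  refine Finset.sum_congr rfl fun S _ => ?_
  rw [Finset.prod_div_distrib]
  push_cast
  ring

/-- Only ⌊n/d⌋ ≤ n/d is used, so the primes of `Q` may be arbitrarily large; the price is the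
absolute values. -/
theorem sum_prod_filter_dvd_le (Q : Finset ℕ) (hQ : ∀ p ∈ Q, p.Prime) (f : ℕ → ℝ) (n : ℕ) :
    ∑ m ∈ Finset.Icc 1 n, ∏ p ∈ Q with p ∣ m, f p ≤
      n * Real.exp (∑ p ∈ Q, |f p - 1| / p) := by
  rw [sum_prod_filter_dvd Q hQ]
  calc _ ≤ ∑ S ∈ Q.powerset, (∏ p ∈ S, |f p - 1|) * ((n : ℝ) / ((∏ p ∈ S, p : ℕ) : ℝ)) := by
        refine Finset.sum_le_sum fun S _ => ?_
        rw [← Finset.abs_prod]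
        exact mul_le_mul (le_abs_self _) Nat.cast_div_le (Nat.cast_nonneg _) (abs_nonneg _)
    _ = n * ∏ p ∈ Q, (1 + |f p - 1| / p) :=
        (prod_one_add_div_eq_sum_powerset Q (fun p => |f p - 1|) n).symm
    _ ≤ _ := by
        refine mul_le_mul_of_nonneg_left ?_ (Nat.cast_nonneg n)
        exact Real.prod_one_add_le_exp_sum Q fun p => by positivity

/-- The error is at most min(1, t) with t = n/d, and min(1, t) ≤ t^(1-η). This is Rankin's trick:
the bound is multiplicative in d, so it can be summed over all d as an Euler product. -/
theorem abs_natCast_div_sub_le_rpow {n d : ℕ} (hn : 0 < n) (hd : 0 < d) {η : ℝ}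
    (h0 : 0 ≤ η) (h1 : η ≤ 1) :
    |((n / d : ℕ) : ℝ) - (n : ℝ) / d| ≤ ((n : ℝ) / d) ^ (1 - η) := by
  have ht : 0 < (n : ℝ) / d := by positivity
  have hle : ((n / d : ℕ) : ℝ) ≤ (n : ℝ) / d := Nat.cast_div_le
  have hlt : (n : ℝ) / d < ((n / d : ℕ) : ℝ) + 1 := by
    rw [← Nat.floor_div_eq_div (K := ℝ)]
    exact Nat.lt_floor_add_one _
  have hnn : (0 : ℝ) ≤ ((n / d : ℕ) : ℝ) := Nat.cast_nonneg _
  rw [abs_sub_comm, abs_of_nonneg (by linarith)]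
  rcases le_total 1 ((n : ℝ) / d) with h | h
  · have := Real.one_le_rpow h (sub_nonneg.2 h1)
    linarith
  · have := Real.rpow_le_rpow_of_exponent_ge ht h (show 1 - η ≤ 1 by linarith)
    rw [Real.rpow_one] at this
    linarith

/-- The fundamental lemma of the sieve, in the form given by Rankin's trick. -/
theorem abs_sum_prod_filter_dvd_sub_le (Q : Finset ℕ) (hQ : ∀ p ∈ Q, p.Prime) (f : ℕ → ℝ)
    {n : ℕ} (hn : 0 < n) {η K : ℝ} (h0 : 0 ≤ η) (h1 : η ≤ 1)
    (hK : ∀ p ∈ Q, (p : ℝ) ^ η ≤ K) :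
    |∑ m ∈ Finset.Icc 1 n, ∏ p ∈ Q with p ∣ m, f p - n * ∏ p ∈ Q, (1 + (f p - 1) / p)| ≤
      n * ((n : ℝ) ^ (-η) * Real.exp (K * ∑ p ∈ Q, |f p - 1| / p)) := by
  have hn' : (0 : ℝ) < n := by exact_mod_cast hn
  rw [sum_prod_filter_dvd Q hQ, prod_one_add_div_eq_sum_powerset, ← Finset.sum_sub_distrib]
  refine (Finset.abs_sum_le_sum_abs _ _).trans ?_
  calc _ ≤ ∑ S ∈ Q.powerset, (n : ℝ) ^ (1 - η) *
        ∏ p ∈ S, (|f p - 1| * ((p : ℝ) ^ (1 - η))⁻¹) := by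
        refine Finset.sum_le_sum fun S hS => ?_
        have hd : 0 < ∏ p ∈ S, p :=
          Finset.prod_pos fun p hp => (hQ p (Finset.mem_powerset.1 hS hp)).pos
        rw [← mul_sub, abs_mul, Finset.abs_prod, Finset.prod_mul_distrib]
        calc _ ≤ (∏ p ∈ S, |f p - 1|) * ((n : ℝ) / ((∏ p ∈ S, p : ℕ) : ℝ)) ^ (1 - η) :=
              mul_le_mul_of_nonneg_left (abs_natCast_div_sub_le_rpow hn hd h0 h1)
                (Finset.prod_nonneg fun _ _ => abs_nonneg _)
          _ = _ := by
              rw [Real.div_rpow hn'.le (Nat.cast_nonneg _), Nat.cast_prod,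
                ← Real.finsetProd_rpow _ _ fun _ _ => Nat.cast_nonneg _, Finset.prod_inv_distrib]
              ring
    _ = (n : ℝ) ^ (1 - η) * ∏ p ∈ Q, (1 + |f p - 1| * ((p : ℝ) ^ (1 - η))⁻¹) := by
        rw [Finset.prod_one_add, Finset.mul_sum]
    _ ≤ (n : ℝ) ^ (1 - η) * Real.exp (∑ p ∈ Q, |f p - 1| * ((p : ℝ) ^ (1 - η))⁻¹) :=
        mul_le_mul_of_nonneg_left
          (Real.prod_one_add_le_exp_sum Q fun p => by positivity) (by positivity)
    _ ≤ (n : ℝ) ^ (1 - η) * Real.exp (K * ∑ p ∈ Q, |f p - 1| / p) := by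
        refine mul_le_mul_of_nonneg_left (Real.exp_le_exp.2 ?_) (by positivity)
        rw [Finset.mul_sum]
        refine Finset.sum_le_sum fun p hp => ?_
        have hp0 : (0 : ℝ) < p := by exact_mod_cast (hQ p hp).pos
        have : ((p : ℝ) ^ (1 - η))⁻¹ = (p : ℝ) ^ η / p := by
          rw [Real.rpow_sub hp0, Real.rpow_one, inv_div]
        rw [this, mul_div_assoc', mul_div_assoc', mul_comm]
        gcongr
        exact hK p hp
    _ = _ := by
        rw [sub_eq_add_neg, Real.rpow_add hn', Real.rpow_one, mul_assoc]

/-! ### The truncation level. -/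

/-- The iterated logarithm `log log n`. -/
noncomputable abbrev logLog (n : ℕ) : ℝ := Real.log (Real.log (n : ℝ))

/-- The truncation level `n ^ (1 / (log log n) ^ 2)`. -/
noncomputable def truncLevel (n : ℕ) : ℝ :=
  Real.exp (Real.exp (logLog n - 2 * Real.log (logLog n)))

theorem tendsto_logLog_atTop : Tendsto logLog atTop atTop :=
  tendsto_log_log_atTop.comp tendsto_natCast_atTop_atTop

theorem log_log_truncLevel (n : ℕ) :
    Real.log (Real.log (truncLevel n)) = logLog n - 2 * Real.log (logLog n) := by
  rw [truncLevel, Real.log_exp, Real.log_exp]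

theorem tendsto_log_log_truncLevel_div :
    Tendsto (fun n => Real.log (Real.log (truncLevel n)) / logLog n) atTop (𝓝 1) := by
  have h : Tendsto (fun x : ℝ => 1 - 2 * (Real.log x / x)) atTop (𝓝 1) := by
    simpa using (Real.isLittleO_log_id_atTop.tendsto_div_nhds_zero.const_mul 2).const_sub 1
  refine (h.comp tendsto_logLog_atTop).congr' ?_
  filter_upwards [tendsto_logLog_atTop.eventually_gt_atTop 0] with n hn
  rw [log_log_truncLevel, Function.comp_apply]
  field_simp

theorem tendsto_log_log_truncLevel_atTop :
    Tendsto (fun n => Real.log (Real.log (truncLevel n))) atTop atTop := by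
  refine (tendsto_log_log_truncLevel_div.pos_mul_atTop one_pos tendsto_logLog_atTop).congr' ?_
  filter_upwards [tendsto_logLog_atTop.eventually_gt_atTop 0] with n hn
  exact div_mul_cancel₀ _ hn.ne'

theorem tendsto_truncLevel_atTop : Tendsto truncLevel atTop atTop := by
  refine (Real.tendsto_exp_atTop.comp
    (Real.tendsto_exp_atTop.comp tendsto_log_log_truncLevel_atTop)).congr fun n => ?_
  rw [Function.comp_apply, Function.comp_apply, log_log_truncLevel, truncLevel]

theorem tendsto_sum_primesLE_div_logLog {c : ℕ → ℝ} {a : ℝ}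
    (hc : Tendsto c (atTop ⊓ 𝓟 {p : ℕ | p.Prime}) (𝓝 a)) :
    Tendsto (fun n : ℕ => (∑ p ∈ Nat.primesLE n, c p / (p : ℝ)) / logLog n) atTop (𝓝 a) := by
  refine ((tendsto_sum_primesLE_mul_div_log_log hc).comp tendsto_natCast_atTop_atTop).congr
    fun n => ?_
  simp

theorem tendsto_sum_primesLE_truncLevel_div_logLog {c : ℕ → ℝ} {a : ℝ}
    (hc : Tendsto c (atTop ⊓ 𝓟 {p : ℕ | p.Prime}) (𝓝 a)) :
    Tendsto (fun n : ℕ => (∑ p ∈ Nat.primesLE ⌊truncLevel n⌋₊, c p / (p : ℝ)) / logLog n)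
      atTop (𝓝 a) := by
  have h := ((tendsto_sum_primesLE_mul_div_log_log hc).comp tendsto_truncLevel_atTop).mul
    tendsto_log_log_truncLevel_div
  rw [mul_one] at h
  refine h.congr' ?_
  filter_upwards [tendsto_log_log_truncLevel_atTop.eventually_gt_atTop 0] with n hn
  exact div_mul_div_cancel₀ hn.ne'

/-- This puts the logarithm of ∏ (1 + u(p)/p) in the form ∑ c(p)/p with c convergent, to which the
weighted prime sums apply. The bounds 1 - 1/w ≤ log w ≤ w - 1 squeeze it. -/
theorem tendsto_natCast_mul_log_one_add_div {l : Filter ℕ} (hl : l ≤ atTop) {u : ℕ → ℝ} {a : ℝ}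
    (hu : Tendsto u l (𝓝 a)) : Tendsto (fun p : ℕ => p * Real.log (1 + u p / p)) l (𝓝 a) := by
  have hp : Tendsto (fun p : ℕ => (p : ℝ)) l atTop := tendsto_natCast_atTop_atTop.mono_left hl
  have h0 : Tendsto (fun p => 1 + u p / p) l (𝓝 1) := by
    simpa using (hu.div_atTop hp).const_add 1
  have h1 : Tendsto (fun p => u p / (1 + u p / p)) l (𝓝 a) := by
    have := hu.div h0 one_ne_zero
    rwa [div_one] at this
  refine tendsto_of_tendsto_of_tendsto_of_le_of_le' h1 hu ?_ ?_ <;>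
    filter_upwards [h0.eventually_const_lt one_pos, hp.eventually_gt_atTop 0] with p hv hp0
  · calc u p / (1 + u p / p) = p * (1 - (1 + u p / p)⁻¹) := by
          have hu' : u p = p * (1 + u p / p - 1) := by rw [add_sub_cancel_left]; field_simp
          generalize 1 + u p / p = w at hv hu'
          rw [hu']
          have := hv.ne'
          field_simp
      _ ≤ _ := mul_le_mul_of_nonneg_left (Real.one_sub_inv_le_log_of_pos hv) hp0.le
  · calc _ ≤ (p : ℝ) * (1 + u p / p - 1) :=
          mul_le_mul_of_nonneg_left (Real.log_le_sub_one_of_pos hv) hp0.le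
      _ = u p := by rw [add_sub_cancel_left]; field_simp

theorem prime_of_mem_primesLE {p N : ℕ} (hp : p ∈ Nat.primesLE N) : p.Prime :=
  (Nat.mem_primesBelow.1 hp).2

theorem eventually_two_mul_exp_le {a b : ℝ} (hab : a < b) :
    ∀ᶠ n : ℕ in atTop, 2 * Real.exp (a * logLog n) ≤ Real.exp (b * logLog n) := by
  filter_upwards [tendsto_logLog_atTop.eventually_ge_atTop (Real.log 2 / (b - a))] with n hn
  rw [div_le_iff₀ (sub_pos.2 hab)] at hn
  rw [← Real.log_le_iff_le_exp (by positivity), Real.log_mul two_ne_zero (Real.exp_ne_zero _),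
    Real.log_exp]
  linarith

theorem log_truncLevel (n : ℕ) (hn : 0 < logLog n) :
    Real.log (truncLevel n) = Real.log n / logLog n ^ 2 := by
  have hlog : Real.log n = Real.exp (logLog n) := by
    rw [Real.exp_log_eq_abs, abs_of_nonneg (Real.log_natCast_nonneg n)]
    -- If log n were 0, the convention log 0 = 0 would give `logLog n = 0`, against `hn`.
    rintro h
    simp [logLog, h] at hn
  rw [truncLevel, Real.log_exp, Real.exp_sub, two_mul, Real.exp_add, Real.exp_log hn, ← sq, hlog]

/-! ### Means of truncated multiplicative functions. -/

/-- Averages of truncated multiplicative functions: if `f p → z > 0` along the primes, then the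
average over `m ≤ n` of the product of `f p` over the primes `p ∣ m` up to the truncation level is
`(log n) ^ (z - 1 + o(1))`. -/
theorem eventually_truncated_mean_bounds {f : ℕ → ℝ} (hf : ∀ p, 0 < f p) {z : ℝ}
    (hz : Tendsto f (atTop ⊓ 𝓟 {p : ℕ | p.Prime}) (𝓝 z)) {δ : ℝ} (hδ : 0 < δ) :
    ∀ᶠ n : ℕ in atTop,
      n * Real.exp ((z - 1 - δ) * logLog n) ≤ ∑ m ∈ Finset.Icc 1 n,
        ∏ p ∈ Nat.primesLE ⌊truncLevel n⌋₊ with p ∣ m, f p ∧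
      ∑ m ∈ Finset.Icc 1 n, ∏ p ∈ Nat.primesLE ⌊truncLevel n⌋₊ with p ∣ m, f p ≤
        n * Real.exp ((z - 1 + δ) * logLog n) := by
  have hu : Tendsto (fun p => f p - 1) (atTop ⊓ 𝓟 {p : ℕ | p.Prime}) (𝓝 (z - 1)) :=
    hz.sub_const 1
  have hmain := tendsto_sum_primesLE_truncLevel_div_logLog
    (tendsto_natCast_mul_log_one_add_div inf_le_left hu)
  have habs := tendsto_sum_primesLE_truncLevel_div_logLog hu.abs
  filter_upwards [hmain.eventually_const_lt (show z - 1 - δ / 2 < z - 1 by linarith),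
    hmain.eventually_lt_const (show z - 1 < z - 1 + δ / 2 by linarith),
    habs.eventually_lt_const (lt_add_one _),
    tendsto_logLog_atTop.eventually_ge_atTop 1,
    -- This threshold is exactly what makes -L² + e(|z - 1| + 1)L ≤ (z - 1 - δ)L, so that the sieve
    -- error is below the target.
    tendsto_logLog_atTop.eventually_ge_atTop (Real.exp 1 * (|z - 1| + 1) - (z - 1 - δ)),
    tendsto_log_log_truncLevel_atTop.eventually_ge_atTop 0,
    eventually_two_mul_exp_le (show z - 1 - δ < z - 1 - δ / 2 by linarith),
    eventually_two_mul_exp_le (show z - 1 + δ / 2 < z - 1 + δ by linarith),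
    eventually_gt_atTop 0] with n hlo hhi herr hL1 hL hy h2lo h2hi hn
  set L := logLog n with hLdef
  set Q := Nat.primesLE ⌊truncLevel n⌋₊ with hQdef
  have hL0 : 0 < L := by linarith
  have hn' : (0 : ℝ) < n := by exact_mod_cast hn
  have hQ : ∀ p ∈ Q, p.Prime := fun p hp => prime_of_mem_primesLE hp
  have hlogy := log_truncLevel n hL0
  have hlogy1 : 1 ≤ Real.log (truncLevel n) := by
    rw [log_log_truncLevel] at hy
    rw [truncLevel, Real.log_exp]
    exact Real.one_le_exp hy
  rw [lt_div_iff₀ hL0] at hlo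
  rw [div_lt_iff₀ hL0] at hhi herr
  set W := ∑ p ∈ Q, p * Real.log (1 + (f p - 1) / p) / p
  have hprod : ∏ p ∈ Q, (1 + (f p - 1) / p) = Real.exp W := by
    rw [Real.exp_sum]
    refine Finset.prod_congr rfl fun p hp => ?_
    have hp1 : (1 : ℝ) < p := by exact_mod_cast (hQ p hp).one_lt
    have hpos : 0 < 1 + (f p - 1) / p := by
      have : 1 + (f p - 1) / p = (p - 1 + f p) / p := by field_simp; ring
      rw [this]
      exact div_pos (by linarith [hf p]) (by linarith)
    rw [mul_div_cancel_left₀ _ (by linarith : (p : ℝ) ≠ 0), Real.exp_log hpos]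
  -- The choice η = 1 / log y keeps p^η ≤ e for p ≤ y, while n^(-η) = exp(-L²) beats every
  -- exp(O(L)).
  have hsieve := abs_sum_prod_filter_dvd_sub_le Q hQ f hn
    (η := (Real.log (truncLevel n))⁻¹) (K := Real.exp 1) (by positivity) (inv_le_one_of_one_le₀ hlogy1)
    (fun p hp => by
      have hp0 : (0 : ℝ) < p := by exact_mod_cast (hQ p hp).pos
      have hpy : (p : ℝ) ≤ truncLevel n :=
        (Nat.le_floor_iff (Real.exp_pos _).le).1 (Nat.lt_succ_iff.1 (Nat.mem_primesBelow.1 hp).1)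
      rw [Real.rpow_def_of_pos hp0]
      refine Real.exp_le_exp.2 ?_
      rw [← div_eq_mul_inv, div_le_one (by linarith)]
      exact Real.log_le_log hp0 hpy)
  have hsmall : (n : ℝ) ^ (-(Real.log (truncLevel n))⁻¹) *
      Real.exp (Real.exp 1 * ∑ p ∈ Q, |f p - 1| / p) ≤ Real.exp ((z - 1 - δ) * L) := by
    have hlogn : Real.log n ≠ 0 := by
      intro h
      simp [hLdef, logLog, h] at hL0
    rw [Real.rpow_def_of_pos hn', ← Real.exp_add]
    refine Real.exp_le_exp.2 ?_
    have : Real.log n * -(Real.log (truncLevel n))⁻¹ = -L ^ 2 := by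
      rw [hlogy, ← hLdef]; field_simp
    rw [this]
    have h1 := mul_le_mul_of_nonneg_left herr.le (Real.exp_pos 1).le
    nlinarith
  rw [hprod] at hsieve
  have hsieve' := hsieve.trans (mul_le_mul_of_nonneg_left hsmall hn'.le)
  rw [abs_le] at hsieve'
  have e1 : Real.exp ((z - 1 - δ / 2) * L) ≤ Real.exp W := Real.exp_le_exp.2 hlo.le
  have e2 : Real.exp W ≤ Real.exp ((z - 1 + δ / 2) * L) := Real.exp_le_exp.2 hhi.le
  have e3 : Real.exp ((z - 1 - δ) * L) ≤ Real.exp ((z - 1 + δ / 2) * L) :=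
    Real.exp_le_exp.2 (by nlinarith)
  constructor
  · have := mul_le_mul_of_nonneg_left (h2lo.trans e1) hn'.le
    linarith [hsieve'.1]
  · have h3 := mul_le_mul_of_nonneg_left h2hi hn'.le
    have h4 := mul_le_mul_of_nonneg_left e2 hn'.le
    have h5 := mul_le_mul_of_nonneg_left e3 hn'.le
    linarith [hsieve'.2]

/-! ### Exponential moments of strongly additive functions. -/

theorem IsStronglyAdditive.eq_sum_primeFactors {g : ℕ → ℝ} (hg : IsStronglyAdditive g) {m : ℕ}
    (hm : m ≠ 0) : g m = ∑ p ∈ m.primeFactors, g p := by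
  induction m using Nat.recOnPosPrimePosCoprime with
  | prime_pow p k hp hk =>
    rw [hg.map_prime_pow p k hp hk, Nat.primeFactors_prime_pow hk.ne' hp, Finset.sum_singleton]
  | zero => exact absurd rfl hm
  | one =>
    have := hg.map_mul 1 1 (Nat.coprime_one_left 1)
    rw [mul_one] at this
    rw [Nat.primeFactors_one, Finset.sum_empty]
    linarith
  | coprime a b ha hb hab iha ihb =>
    rw [hg.map_mul a b hab, iha (by omega), ihb (by omega), hab.primeFactors_mul,
      Finset.sum_union hab.disjoint_primeFactors]

theorem primeFactors_eq_filter_primesLE {m n : ℕ} (hm : m ∈ Finset.Icc 1 n) :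
    m.primeFactors = {p ∈ Nat.primesLE n | p ∣ m} := by
  rw [Finset.mem_Icc] at hm
  ext p
  rw [Nat.mem_primeFactors, Finset.mem_filter, Nat.primesLE, Nat.mem_primesBelow]
  constructor
  · rintro ⟨hp, hd, -⟩
    exact ⟨⟨Nat.lt_succ_of_le ((Nat.le_of_dvd (by omega) hd).trans hm.2), hp⟩, hd⟩
  · rintro ⟨⟨-, hp⟩, hd⟩
    exact ⟨hp, hd, by omega⟩

/-- The contribution to `g m` of the primes up to the truncation level. -/
noncomputable def truncSum (g : ℕ → ℝ) (n m : ℕ) : ℝ :=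
  ∑ p ∈ Nat.primesLE ⌊truncLevel n⌋₊ with p ∣ m, g p

theorem exp_mul_truncSum (g : ℕ → ℝ) (θ : ℝ) (n m : ℕ) :
    Real.exp (θ * truncSum g n m) =
      ∏ p ∈ Nat.primesLE ⌊truncLevel n⌋₊ with p ∣ m, Real.exp (θ * g p) := by
  rw [truncSum, Finset.mul_sum, Real.exp_sum]

theorem eventually_truncLevel_le : ∀ᶠ n : ℕ in atTop, ⌊truncLevel n⌋₊ ≤ n := by
  filter_upwards [tendsto_logLog_atTop.eventually_ge_atTop 1, eventually_gt_atTop 0] with n hL hn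
  have hn' : (0 : ℝ) < n := by exact_mod_cast hn
  refine Nat.floor_le_of_le ?_
  rw [← Real.log_le_log_iff (show 0 < truncLevel n from Real.exp_pos _) hn', log_truncLevel n (by linarith)]
  exact div_le_self (Real.log_natCast_nonneg n) (one_le_pow₀ hL)

theorem IsStronglyAdditive.sub_truncSum_eq {g : ℕ → ℝ} (hg : IsStronglyAdditive g) {m n : ℕ}
    (hm : m ∈ Finset.Icc 1 n) (hn : ⌊truncLevel n⌋₊ ≤ n) :
    g m - truncSum g n m =
      ∑ p ∈ Nat.primesLE n \ Nat.primesLE ⌊truncLevel n⌋₊ with p ∣ m, g p := by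
  have hsub : Nat.primesLE ⌊truncLevel n⌋₊ ⊆ Nat.primesLE n := by
    intro p hp
    rw [Nat.primesLE, Nat.mem_primesBelow] at hp ⊢
    exact ⟨by omega, hp.2⟩
  have hm0 : m ≠ 0 := by have := (Finset.mem_Icc.1 hm).1; omega
  rw [hg.eq_sum_primeFactors hm0, primeFactors_eq_filter_primesLE hm, truncSum, sub_eq_iff_eq_add,
    Finset.sum_filter, Finset.sum_filter, Finset.sum_filter]
  exact (Finset.sum_sdiff hsub).symm

section MomentGeneratingFunction

variable {g : ℕ → ℝ} {lam : ℝ}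

theorem tendsto_exp_mul_primes (hlim : Tendsto g (atTop ⊓ 𝓟 {p : ℕ | p.Prime}) (𝓝 lam)) (θ : ℝ) :
    Tendsto (fun p => Real.exp (θ * g p)) (atTop ⊓ 𝓟 {p : ℕ | p.Prime})
      (𝓝 (Real.exp (θ * lam))) :=
  (Real.continuous_exp.tendsto _).comp (hlim.const_mul θ)

/-- Since g(p) → λ > 0, the primes with g(p) ≤ 0 all lie below the truncation level once n is large.
-/
theorem eventually_truncSum_le (hg : IsStronglyAdditive g) (hlam : 0 < lam)
    (hlim : Tendsto g (atTop ⊓ 𝓟 {p : ℕ | p.Prime}) (𝓝 lam)) :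
    ∀ᶠ n : ℕ in atTop, ∀ m ∈ Finset.Icc 1 n, truncSum g n m ≤ g m := by
  obtain ⟨N, hN⟩ := eventually_atTop.1
    (eventually_inf_principal.1 (hlim.eventually_const_lt hlam))
  filter_upwards [eventually_truncLevel_le, tendsto_truncLevel_atTop.eventually_ge_atTop (N : ℝ)]
    with n hn hNn m hm
  rw [← sub_nonneg, hg.sub_truncSum_eq hm hn]
  refine Finset.sum_nonneg fun p hp => ?_
  obtain ⟨hp, -⟩ := Finset.mem_filter.1 hp
  obtain ⟨hp, hp'⟩ := Finset.mem_sdiff.1 hp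
  have hpp := prime_of_mem_primesLE hp
  rw [Nat.primesLE, Nat.mem_primesBelow] at hp'
  have hNf : N ≤ ⌊truncLevel n⌋₊ := Nat.le_floor hNn
  refine (hN p ?_ hpp).le
  by_contra h
  exact hp' ⟨by omega, hpp⟩

theorem eventually_truncated_mgf_bounds
    (hlim : Tendsto g (atTop ⊓ 𝓟 {p : ℕ | p.Prime}) (𝓝 lam)) (θ : ℝ) {δ : ℝ} (hδ : 0 < δ) :
    ∀ᶠ n : ℕ in atTop,
      n * Real.exp ((Real.exp (θ * lam) - 1 - δ) * logLog n) ≤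
        ∑ m ∈ Finset.Icc 1 n, Real.exp (θ * truncSum g n m) ∧
      ∑ m ∈ Finset.Icc 1 n, Real.exp (θ * truncSum g n m) ≤
        n * Real.exp ((Real.exp (θ * lam) - 1 + δ) * logLog n) := by
  simp_rw [exp_mul_truncSum]
  exact eventually_truncated_mean_bounds (fun p => Real.exp_pos _)
    (tendsto_exp_mul_primes hlim θ) hδ

/-- For θ ≥ 0 the limit exp(θλ) - 1 is nonnegative, so the absolute values in the crude sieve bound
cost nothing asymptotically. For θ ≤ 0 that bound would be lossy, and the remainder is dropped
instead. -/
theorem eventually_mgf_le (hg : IsStronglyAdditive g) (hlam : 0 < lam)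
    (hlim : Tendsto g (atTop ⊓ 𝓟 {p : ℕ | p.Prime}) (𝓝 lam)) (θ : ℝ) {δ : ℝ} (hδ : 0 < δ) :
    ∀ᶠ n : ℕ in atTop, ∑ m ∈ Finset.Icc 1 n, Real.exp (θ * g m) ≤
      n * Real.exp ((Real.exp (θ * lam) - 1 + δ) * logLog n) := by
  rcases le_total 0 θ with hθ | hθ
  · have habs := tendsto_sum_primesLE_div_logLog
      ((tendsto_exp_mul_primes hlim θ).sub_const 1).abs
    rw [abs_of_nonneg (sub_nonneg.2 (Real.one_le_exp (mul_nonneg hθ hlam.le)))] at habs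
    filter_upwards [habs.eventually_lt_const (lt_add_of_pos_right _ hδ),
      tendsto_logLog_atTop.eventually_gt_atTop 0] with n hn hL
    rw [div_lt_iff₀ hL] at hn
    have h := sum_prod_filter_dvd_le (Nat.primesLE n) (fun p hp => prime_of_mem_primesLE hp)
      (fun p => Real.exp (θ * g p)) n
    refine le_trans (le_of_eq (Finset.sum_congr rfl fun m hm => ?_)) (h.trans ?_)
    · have hm0 : m ≠ 0 := by have := (Finset.mem_Icc.1 hm).1; omega
      rw [hg.eq_sum_primeFactors hm0, primeFactors_eq_filter_primesLE hm, Finset.mul_sum,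
        Real.exp_sum]
    · exact mul_le_mul_of_nonneg_left (Real.exp_le_exp.2 hn.le) (Nat.cast_nonneg n)
  · filter_upwards [eventually_truncated_mgf_bounds hlim θ hδ,
      eventually_truncSum_le hg hlam hlim] with n hn hR
    refine (Finset.sum_le_sum fun m hm => Real.exp_le_exp.2 ?_).trans hn.2
    exact mul_le_mul_of_nonpos_left (hR m hm) hθ

/-- The joint moment generating function of the truncated sum, at `θ ≤ 0`, and of the remainder. -/
theorem eventually_joint_mgf_le (hg : IsStronglyAdditive g) (hlam : 0 < lam)
    (hlim : Tendsto g (atTop ⊓ 𝓟 {p : ℕ | p.Prime}) (𝓝 lam)) {θ : ℝ} (hθ : θ ≤ 0) (t : ℝ) :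
    ∀ᶠ n : ℕ in atTop, ∑ m ∈ Finset.Icc 1 n,
      Real.exp (θ * truncSum g n m + t * (g m - truncSum g n m)) ≤
        n * Real.exp (2 * logLog n) := by
  have h1 := tendsto_sum_primesLE_truncLevel_div_logLog
    ((tendsto_exp_mul_primes hlim θ).sub_const 1).abs
  have h2 := tendsto_sum_primesLE_truncLevel_div_logLog
    ((tendsto_exp_mul_primes hlim t).sub_const 1).abs
  have h3 := tendsto_sum_primesLE_div_logLog
    ((tendsto_exp_mul_primes hlim t).sub_const 1).abs
  -- The primes above the truncation level contribute o(L) whatever t is; the exponent 2 therefore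
  -- does not depend on t.
  have h := h1.add (h3.sub h2)
  rw [sub_self, add_zero] at h
  have hlt : |Real.exp (θ * lam) - 1| < 2 := by
    have : Real.exp (θ * lam) ≤ 1 :=
      Real.exp_le_one_iff.2 (mul_nonpos_of_nonpos_of_nonneg hθ hlam.le)
    rw [abs_lt]
    constructor <;> linarith [Real.exp_pos (θ * lam)]
  filter_upwards [h.eventually_lt_const hlt, tendsto_logLog_atTop.eventually_gt_atTop 0,
    eventually_truncLevel_le] with n hn hL hle
  rw [← sub_div, ← add_div, div_lt_iff₀ hL] at hn
  set Q := Nat.primesLE ⌊truncLevel n⌋₊ with hQ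
  have hsub : Q ⊆ Nat.primesLE n := by
    intro p hp
    rw [hQ, Nat.primesLE, Nat.mem_primesBelow] at hp
    rw [Nat.primesLE, Nat.mem_primesBelow]
    exact ⟨by omega, hp.2⟩
  set f : ℕ → ℝ := fun p => if p ∈ Q then Real.exp (θ * g p) else Real.exp (t * g p) with hf
  have hfQ : ∀ p ∈ Q, f p = Real.exp (θ * g p) := fun p hp => if_pos hp
  have hfQ' : ∀ p ∈ Nat.primesLE n \ Q, f p = Real.exp (t * g p) := fun p hp =>
    if_neg (Finset.mem_sdiff.1 hp).2
  have hB := sum_prod_filter_dvd_le (Nat.primesLE n) (fun p hp => prime_of_mem_primesLE hp) f n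
  refine le_trans (le_of_eq (Finset.sum_congr rfl fun m hm => ?_)) (hB.trans ?_)
  · rw [hg.sub_truncSum_eq hm hle, Real.exp_add, exp_mul_truncSum, Finset.mul_sum, Real.exp_sum,
      Finset.prod_filter, Finset.prod_filter, Finset.prod_filter, ← Finset.prod_sdiff hsub, mul_comm]
    congr 1 <;> refine Finset.prod_congr rfl fun p hp => ?_
    · rw [hfQ' p hp]
    · rw [hfQ p hp]
  · refine mul_le_mul_of_nonneg_left (Real.exp_le_exp.2 ?_) (Nat.cast_nonneg n)
    rw [← Finset.sum_sdiff hsub] at hn ⊢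
    rw [add_sub_cancel_right] at hn
    refine le_trans (le_of_eq ?_) hn.le
    rw [add_comm]
    congr 1 <;> refine Finset.sum_congr rfl fun p hp => ?_
    · rw [hfQ p hp]
    · rw [hfQ' p hp]

/-- Here x is the truncated sum, r the remainder and a the tolerated size of r. If r ≤ a, the loss
is at most exp(θa); if r > a, the bracket is nonpositive. It serves as a smooth substitute for the
indicator of r ≤ a. -/
theorem exp_mul_mul_one_sub_exp_le {θ t a x r : ℝ} (hθ : θ ≤ 0) (ht : 0 ≤ t) :
    Real.exp (θ * a) * (Real.exp (θ * x) - Real.exp (-(t * a)) * Real.exp (θ * x + t * r)) ≤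
      Real.exp (θ * (x + r)) := by
  have h1 : Real.exp (-(t * a)) * Real.exp (θ * x + t * r) =
      Real.exp (θ * x) * Real.exp (t * (r - a)) := by
    rw [← Real.exp_add, ← Real.exp_add]; ring_nf
  rw [h1]
  rcases le_total r a with h | h
  · calc _ ≤ Real.exp (θ * a) * Real.exp (θ * x) :=
          mul_le_mul_of_nonneg_left (sub_le_self _ (by positivity)) (Real.exp_pos _).le
      _ = Real.exp (θ * a + θ * x) := (Real.exp_add _ _).symm
      _ ≤ _ := Real.exp_le_exp.2 (by nlinarith)
  · refine le_trans ?_ (Real.exp_pos _).le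
    refine mul_nonpos_of_nonneg_of_nonpos (Real.exp_pos _).le (sub_nonpos.2 ?_)
    exact le_mul_of_one_le_right (Real.exp_pos _).le
      (Real.one_le_exp (mul_nonneg ht (sub_nonneg.2 h)))

theorem eventually_le_mgf (hg : IsStronglyAdditive g) (hlam : 0 < lam)
    (hlim : Tendsto g (atTop ⊓ 𝓟 {p : ℕ | p.Prime}) (𝓝 lam)) (θ : ℝ) {δ : ℝ} (hδ : 0 < δ) :
    ∀ᶠ n : ℕ in atTop, n * Real.exp ((Real.exp (θ * lam) - 1 - δ) * logLog n) ≤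
      ∑ m ∈ Finset.Icc 1 n, Real.exp (θ * g m) := by
  rcases le_total 0 θ with hθ | hθ
  · filter_upwards [eventually_truncated_mgf_bounds hlim θ hδ,
      eventually_truncSum_le hg hlam hlim] with n hn hR
    refine hn.1.trans (Finset.sum_le_sum fun m hm => Real.exp_le_exp.2 ?_)
    exact mul_le_mul_of_nonneg_left (hR m hm) hθ
  · set z := Real.exp (θ * lam) with hz
    have hz0 : 0 < z := Real.exp_pos _
    obtain ⟨ε, hε, hε1, hεδ⟩ : ∃ ε : ℝ, 0 < ε ∧ ε ≤ 1 ∧ (2 - θ) * ε ≤ δ := by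
      have h2 : 0 < 2 - θ := by linarith
      refine ⟨min 1 (δ / (2 - θ)), by positivity, min_le_left _ _, ?_⟩
      rw [mul_comm, ← le_div_iff₀ h2]
      exact min_le_right _ _
    filter_upwards [eventually_truncated_mgf_bounds hlim θ hε,
      -- With t = 4/ε and a = εL the factor exp(-ta) is exp(-4L), which brings the joint moment down
      -- to n exp(-2L). As z > 0 and ε ≤ 1, this is negligible against n exp((z - 1 - ε)L).
      eventually_joint_mgf_le hg hlam hlim hθ (4 / ε),
      eventually_two_mul_exp_le (show -2 < z - 1 - ε by linarith),
      eventually_two_mul_exp_le (show z - 1 - 2 * ε < z - 1 - ε by linarith),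
      tendsto_logLog_atTop.eventually_gt_atTop 0] with n hX hJ h2 h3 hL
    set L := logLog n
    have hn0 : (0 : ℝ) ≤ n := Nat.cast_nonneg n
    calc (n : ℝ) * Real.exp ((z - 1 - δ) * L)
        ≤ Real.exp (θ * (ε * L)) * (n * Real.exp ((z - 1 - 2 * ε) * L)) := by
          rw [mul_left_comm, ← Real.exp_add]
          refine mul_le_mul_of_nonneg_left (Real.exp_le_exp.2 ?_) hn0
          nlinarith
      _ ≤ Real.exp (θ * (ε * L)) * (∑ m ∈ Finset.Icc 1 n, Real.exp (θ * truncSum g n m) -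
            Real.exp (-(4 / ε * (ε * L))) * ∑ m ∈ Finset.Icc 1 n,
              Real.exp (θ * truncSum g n m + 4 / ε * (g m - truncSum g n m))) := by
          refine mul_le_mul_of_nonneg_left ?_ (Real.exp_pos _).le
          have e1 : Real.exp (-(4 / ε * (ε * L))) * (n * Real.exp (2 * L)) =
              n * Real.exp (-2 * L) := by
            rw [mul_left_comm, ← Real.exp_add]
            congr 2
            field_simp
            ring
          have e2 := mul_le_mul_of_nonneg_left hJ (Real.exp_pos (-(4 / ε * (ε * L)))).le
          rw [e1] at e2
          have e3 := mul_le_mul_of_nonneg_left h2 hn0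
          have e4 := mul_le_mul_of_nonneg_left h3 hn0
          linarith [hX.1]
      _ = ∑ m ∈ Finset.Icc 1 n, Real.exp (θ * (ε * L)) * (Real.exp (θ * truncSum g n m) -
            Real.exp (-(4 / ε * (ε * L))) *
              Real.exp (θ * truncSum g n m + 4 / ε * (g m - truncSum g n m))) := by
          rw [← Finset.mul_sum, Finset.sum_sub_distrib, Finset.mul_sum (Finset.Icc 1 n)]
      _ ≤ ∑ m ∈ Finset.Icc 1 n, Real.exp (θ * g m) := by
          refine Finset.sum_le_sum fun m _ => ?_
          have := exp_mul_mul_one_sub_exp_le (a := ε * L) (x := truncSum g n m)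
            (r := g m - truncSum g n m) hθ (show 0 ≤ 4 / ε by positivity)
          rwa [add_sub_cancel] at this

end MomentGeneratingFunction

/-! ### The rate function as a Legendre transform. -/

/-- The real-valued expression of the Poisson rate function. -/
noncomputable def poissonRateReal (lam x : ℝ) : ℝ :=
  x / lam * Real.log (x / lam) - x / lam + 1

theorem poissonRate_of_nonneg (lam : ℝ) {x : ℝ} (hx : 0 ≤ x) :
    poissonRate lam x = (poissonRateReal lam x : EReal) := if_pos hx

theorem poissonRate_of_neg (lam : ℝ) {x : ℝ} (hx : x < 0) : poissonRate lam x = ⊤ :=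
  if_neg hx.not_ge

theorem continuous_poissonRateReal (lam : ℝ) : Continuous (poissonRateReal lam) := by
  have h : Continuous fun x : ℝ => x / lam := continuous_id.div_const lam
  exact ((Real.continuous_mul_log.comp h).sub h).add continuous_const

theorem poissonRate_nonneg {lam : ℝ} (hlam : 0 < lam) (x : ℝ) : 0 ≤ poissonRate lam x := by
  rcases lt_or_ge x 0 with hx | hx
  · rw [poissonRate_of_neg lam hx]; exact le_top
  · rw [poissonRate_of_nonneg lam hx]
    refine EReal.coe_nonneg.2 ?_
    rw [poissonRateReal]
    have hu : 0 ≤ x / lam := by positivity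
    generalize x / lam = u at hu
    rcases hu.eq_or_lt with rfl | hu
    · simp
    · have := mul_le_mul_of_nonneg_left (Real.one_sub_inv_le_log_of_pos hu) hu.le
      rw [mul_sub, mul_inv_cancel₀ hu.ne'] at this
      linarith

theorem lowerSemicontinuous_poissonRate (lam : ℝ) : LowerSemicontinuous (poissonRate lam) := by
  intro x c hc
  rcases lt_or_ge x 0 with hx | hx
  · filter_upwards [Iio_mem_nhds hx] with y hy
    rw [poissonRate_of_neg lam hy, ← poissonRate_of_neg lam hx]
    exact hc
  · rw [poissonRate_of_nonneg lam hx] at hc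
    have hcont : Continuous fun y => (poissonRateReal lam y : EReal) :=
      continuous_coe_real_ereal.comp (continuous_poissonRateReal lam)
    filter_upwards [(hcont.tendsto x).eventually_const_lt hc] with y hy
    rcases lt_or_ge y 0 with hy0 | hy0
    · rw [poissonRate_of_neg lam hy0]; exact hy.trans_le le_top
    · rwa [poissonRate_of_nonneg lam hy0]

theorem mul_sub_exp_eq_poissonRateReal {lam x : ℝ} (hlam : 0 < lam) (hx : 0 < x) :
    Real.log (x / lam) / lam * x - (Real.exp (Real.log (x / lam) / lam * lam) - 1) =
      poissonRateReal lam x := by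
  rw [div_mul_cancel₀ _ hlam.ne', Real.exp_log (by positivity), poissonRateReal]
  ring

theorem exists_nonneg_lt_legendre {lam a c : ℝ} (hlam : 0 < lam) (ha : lam ≤ a)
    (hc : (c : EReal) < poissonRate lam a) :
    ∃ θ : ℝ, 0 ≤ θ ∧ c < θ * a - (Real.exp (θ * lam) - 1) := by
  have ha0 : 0 < a := by linarith
  rw [poissonRate_of_nonneg lam ha0.le, EReal.coe_lt_coe_iff] at hc
  refine ⟨Real.log (a / lam) / lam, ?_, ?_⟩
  · exact div_nonneg (Real.log_nonneg ((one_le_div hlam).2 ha)) hlam.le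
  · rwa [mul_sub_exp_eq_poissonRateReal hlam ha0]

/-- For a > 0 the maximiser θ = log(a/λ)/λ is explicit. For a ≤ 0 the supremum is only approached as
θ → -∞, with value 1 at a = 0 and +∞ below. -/
theorem exists_nonpos_lt_legendre {lam a c : ℝ} (hlam : 0 < lam) (ha : a ≤ lam)
    (hc : (c : EReal) < poissonRate lam a) :
    ∃ θ : ℝ, θ ≤ 0 ∧ c < θ * a - (Real.exp (θ * lam) - 1) := by
  rcases lt_trichotomy a 0 with ha0 | rfl | ha0
  · have h : Tendsto (fun θ : ℝ => θ * a) atBot atTop :=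
      tendsto_id.atBot_mul_const_of_neg ha0
    obtain ⟨θ, hθ, hθ0⟩ := ((h.eventually_gt_atTop c).and (eventually_le_atBot 0)).exists
    have : Real.exp (θ * lam) ≤ 1 :=
      Real.exp_le_one_iff.2 (mul_nonpos_of_nonpos_of_nonneg hθ0 hlam.le)
    exact ⟨θ, hθ0, by linarith⟩
  · rw [poissonRate_of_nonneg lam le_rfl, EReal.coe_lt_coe_iff] at hc
    have h : Tendsto (fun θ : ℝ => θ * 0 - (Real.exp (θ * lam) - 1)) atBot (𝓝 (0 - (0 - 1))) := by
      simp_rw [mul_zero]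
      exact ((Real.tendsto_exp_atBot.comp
        (tendsto_id.atBot_mul_const hlam)).sub_const 1).const_sub 0
    have hc1 : c < 0 - (0 - 1) := by simpa [poissonRateReal] using hc
    obtain ⟨θ, hθ, hθ0⟩ := ((h.eventually_const_lt hc1).and (eventually_le_atBot 0)).exists
    exact ⟨θ, hθ0, hθ⟩
  · rw [poissonRate_of_nonneg lam ha0.le, EReal.coe_lt_coe_iff] at hc
    refine ⟨Real.log (a / lam) / lam, ?_, ?_⟩
    · exact div_nonpos_of_nonpos_of_nonneg
        (Real.log_nonpos (by positivity) ((div_le_one hlam).2 ha)) hlam.le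
    · rwa [mul_sub_exp_eq_poissonRateReal hlam ha0]

/-! ### The Gärtner–Ellis theorem for Poisson exponential moments. -/

/-- The exponential moments of `P n` at scale `b n` grow as those of a Poisson sum with jumps of
size `lam`. -/
def HasPoissonExpMoments (P : ℕ → Measure ℝ) (b : ℕ → ℝ) (lam : ℝ) : Prop :=
  ∀ θ δ : ℝ, 0 < δ → ∀ᶠ n in atTop,
    ENNReal.ofReal (Real.exp ((Real.exp (θ * lam) - 1 - δ) * b n)) ≤
      ∫⁻ x, ENNReal.ofReal (Real.exp (θ * b n * x)) ∂P n ∧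
    ∫⁻ x, ENNReal.ofReal (Real.exp (θ * b n * x)) ∂P n ≤
      ENNReal.ofReal (Real.exp ((Real.exp (θ * lam) - 1 + δ) * b n))

theorem ofReal_exp_mul_ofReal_exp (x y : ℝ) :
    ENNReal.ofReal (Real.exp x) * ENNReal.ofReal (Real.exp y) =
      ENNReal.ofReal (Real.exp (x + y)) := by
  rw [← ENNReal.ofReal_mul (Real.exp_pos x).le, Real.exp_add]

theorem eventually_two_mul_ofReal_exp_le {b : ℕ → ℝ} (hb : Tendsto b atTop atTop) {s t : ℝ}
    (hst : s < t) : ∀ᶠ n in atTop,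
      ENNReal.ofReal (Real.exp (s * b n)) + ENNReal.ofReal (Real.exp (s * b n)) ≤
        ENNReal.ofReal (Real.exp (t * b n)) := by
  filter_upwards [hb.eventually_ge_atTop (Real.log 2 / (t - s))] with n hn
  rw [div_le_iff₀ (sub_pos.2 hst)] at hn
  rw [← ENNReal.ofReal_add (Real.exp_pos _).le (Real.exp_pos _).le, ← two_mul]
  refine ENNReal.ofReal_le_ofReal ?_
  rw [← Real.log_le_iff_le_exp (by positivity), Real.log_mul two_ne_zero (Real.exp_ne_zero _),
    Real.log_exp]
  linarith

theorem measurable_ofReal_exp_mul (s : ℝ) :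
    Measurable fun x : ℝ => ENNReal.ofReal (Real.exp (s * x)) := by fun_prop

namespace HasPoissonExpMoments

variable {P : ℕ → Measure ℝ} {b : ℕ → ℝ} {lam : ℝ}

theorem eventually_measure_le (h : HasPoissonExpMoments P b lam) (hb : Tendsto b atTop atTop)
    {θ a c : ℝ} (hc : c < θ * a - (Real.exp (θ * lam) - 1)) {S : Set ℝ}
    (hS : ∀ x ∈ S, θ * a ≤ θ * x) :
    ∀ᶠ n in atTop, P n S ≤ ENNReal.ofReal (Real.exp (-c * b n)) := by
  -- The slack δ is taken equal to the whole gap in `hc`, so the Markov bound has exponent exactly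
  -- -c.
  filter_upwards [h θ _ (sub_pos.2 hc), hb.eventually_ge_atTop 0] with n hn hbn
  have hmarkov := mul_meas_ge_le_lintegral (μ := P n) (measurable_ofReal_exp_mul (θ * b n))
    (ENNReal.ofReal (Real.exp (θ * a * b n)))
  have hsub : P n S ≤ P n {x | ENNReal.ofReal (Real.exp (θ * a * b n)) ≤
      ENNReal.ofReal (Real.exp (θ * b n * x))} := by
    refine measure_mono fun x hx => ENNReal.ofReal_le_ofReal (Real.exp_le_exp.2 ?_)
    have := mul_le_mul_of_nonneg_right (hS x hx) hbn
    linarith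
  have h1 := ((mul_le_mul_right hsub _).trans hmarkov).trans hn.2
  have h2 := mul_le_mul_right h1 (ENNReal.ofReal (Real.exp (-(θ * a * b n))))
  rw [← mul_assoc, ofReal_exp_mul_ofReal_exp, ofReal_exp_mul_ofReal_exp, neg_add_cancel,
    Real.exp_zero, ENNReal.ofReal_one, one_mul] at h2
  refine h2.trans (le_of_eq ?_)
  congr 2
  ring

theorem exists_eventually_measure_le_left (h : HasPoissonExpMoments P b lam)
    (hb : Tendsto b atTop atTop) (hlam : 0 < lam) {F : Set ℝ} (hF : IsClosed F)
    (hFlam : ∀ x ∈ F, x ≤ lam) {c : ℝ} (hc : ∀ x ∈ F, (c : EReal) < poissonRate lam x) :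
    ∃ c', c < c' ∧ ∀ᶠ n in atTop, P n F ≤ ENNReal.ofReal (Real.exp (-c' * b n)) := by
  rcases F.eq_empty_or_nonempty with rfl | hne
  · exact ⟨c + 1, by linarith, by simp⟩
  have hbdd : BddAbove F := ⟨lam, hFlam⟩
  have ha := hF.csSup_mem hne hbdd
  obtain ⟨θ, hθ, hcθ⟩ := exists_nonpos_lt_legendre hlam (hFlam _ ha) (hc _ ha)
  obtain ⟨c', hc1, hc2⟩ := exists_between hcθ
  exact ⟨c', hc1, h.eventually_measure_le hb hc2 fun x hx =>
    mul_le_mul_of_nonpos_left (le_csSup hbdd hx) hθ⟩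

theorem exists_eventually_measure_le_right (h : HasPoissonExpMoments P b lam)
    (hb : Tendsto b atTop atTop) (hlam : 0 < lam) {F : Set ℝ} (hF : IsClosed F)
    (hFlam : ∀ x ∈ F, lam ≤ x) {c : ℝ} (hc : ∀ x ∈ F, (c : EReal) < poissonRate lam x) :
    ∃ c', c < c' ∧ ∀ᶠ n in atTop, P n F ≤ ENNReal.ofReal (Real.exp (-c' * b n)) := by
  rcases F.eq_empty_or_nonempty with rfl | hne
  · exact ⟨c + 1, by linarith, by simp⟩
  have hbdd : BddBelow F := ⟨lam, hFlam⟩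
  have ha := hF.csInf_mem hne hbdd
  obtain ⟨θ, hθ, hcθ⟩ := exists_nonneg_lt_legendre hlam (hFlam _ ha) (hc _ ha)
  obtain ⟨c', hc1, hc2⟩ := exists_between hcθ
  exact ⟨c', hc1, h.eventually_measure_le hb hc2 fun x hx =>
    mul_le_mul_of_nonneg_left (csInf_le hbdd hx) hθ⟩

/-- The set is cut at the mean λ. Each piece lies in a half-line ending at its own point nearest to
λ, where one exponential Markov bound suffices. The strict gains over c absorb the factor 2 from
adding the pieces. -/
theorem eventually_measure_closed_le (h : HasPoissonExpMoments P b lam)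
    (hb : Tendsto b atTop atTop) (hlam : 0 < lam) {F : Set ℝ} (hF : IsClosed F) {c : ℝ}
    (hc : ∀ x ∈ F, (c : EReal) < poissonRate lam x) :
    ∀ᶠ n in atTop, P n F ≤ ENNReal.ofReal (Real.exp (-c * b n)) := by
  obtain ⟨c₁, hc₁, h₁⟩ := h.exists_eventually_measure_le_left hb hlam (hF.inter isClosed_Iic)
    (fun x hx => hx.2) fun x hx => hc x hx.1
  obtain ⟨c₂, hc₂, h₂⟩ := h.exists_eventually_measure_le_right hb hlam (hF.inter isClosed_Ici)
    (fun x hx => hx.2) fun x hx => hc x hx.1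
  filter_upwards [h₁, h₂, hb.eventually_ge_atTop 0,
    eventually_two_mul_ofReal_exp_le hb (neg_lt_neg (lt_min hc₁ hc₂))] with n hn₁ hn₂ hbn hn
  have hmono : ∀ c', min c₁ c₂ ≤ c' → ENNReal.ofReal (Real.exp (-c' * b n)) ≤
      ENNReal.ofReal (Real.exp (-min c₁ c₂ * b n)) := fun c' hc' =>
    ENNReal.ofReal_le_ofReal (Real.exp_le_exp.2
      (mul_le_mul_of_nonneg_right (neg_le_neg hc') hbn))
  calc P n F = P n (F ∩ Set.Iic lam ∪ F ∩ Set.Ici lam) := by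
        rw [← Set.inter_union_distrib_left, Set.Iic_union_Ici, Set.inter_univ]
    _ ≤ P n (F ∩ Set.Iic lam) + P n (F ∩ Set.Ici lam) := measure_union_le _ _
    _ ≤ _ := add_le_add (hn₁.trans (hmono _ (min_le_left _ _)))
        (hn₂.trans (hmono _ (min_le_right _ _)))
    _ ≤ _ := hn

/-- Outside the ball, either exp(tβ(y - x - r)) or exp(tβ(x - r - y)) is at least 1. Integrated,
this bounds the tilted mass outside the ball by exponential moments at θ ± t, without introducing a
tilted measure. -/
theorem exp_mul_le_indicator_add {θ t β x r y : ℝ} (hβ : 0 ≤ β) (ht : 0 ≤ t) :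
    ENNReal.ofReal (Real.exp (θ * β * y)) ≤
      (Metric.ball x r).indicator
        (fun _ => ENNReal.ofReal (Real.exp ((θ * x + |θ| * r) * β))) y +
      ENNReal.ofReal (Real.exp (-(t * (x + r)) * β)) *
        ENNReal.ofReal (Real.exp ((θ + t) * β * y)) +
      ENNReal.ofReal (Real.exp (t * (x - r) * β)) *
        ENNReal.ofReal (Real.exp ((θ - t) * β * y)) := by
  by_cases hy : y ∈ Metric.ball x r
  · rw [Set.indicator_of_mem hy, add_assoc]
    refine le_trans (ENNReal.ofReal_le_ofReal (Real.exp_le_exp.2 ?_)) le_self_add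
    rw [Metric.mem_ball, Real.dist_eq] at hy
    have h1 : θ * (y - x) ≤ |θ| * r := (le_abs_self _).trans <| by
      rw [abs_mul]; exact mul_le_mul_of_nonneg_left hy.le (abs_nonneg θ)
    nlinarith
  · rw [Metric.mem_ball, Real.dist_eq, not_lt, le_abs'] at hy
    have htβ := mul_nonneg ht hβ
    rcases hy with hy | hy
    · refine le_trans ?_ le_add_self
      rw [ofReal_exp_mul_ofReal_exp]
      refine ENNReal.ofReal_le_ofReal (Real.exp_le_exp.2 ?_)
      nlinarith
    · rw [add_right_comm]
      refine le_trans ?_ le_add_self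
      rw [ofReal_exp_mul_ofReal_exp]
      refine ENNReal.ofReal_le_ofReal (Real.exp_le_exp.2 ?_)
      nlinarith

theorem lintegral_exp_mul_le (μ : Measure ℝ) {θ t β x r : ℝ} (hβ : 0 ≤ β) (ht : 0 ≤ t) :
    ∫⁻ y, ENNReal.ofReal (Real.exp (θ * β * y)) ∂μ ≤
      ENNReal.ofReal (Real.exp ((θ * x + |θ| * r) * β)) * μ (Metric.ball x r) +
      ENNReal.ofReal (Real.exp (-(t * (x + r)) * β)) *
        ∫⁻ y, ENNReal.ofReal (Real.exp ((θ + t) * β * y)) ∂μ +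
      ENNReal.ofReal (Real.exp (t * (x - r) * β)) *
        ∫⁻ y, ENNReal.ofReal (Real.exp ((θ - t) * β * y)) ∂μ := by
  refine (lintegral_mono fun y => exp_mul_le_indicator_add (x := x) (r := r) hβ ht).trans ?_
  rw [lintegral_add_right _ ((measurable_ofReal_exp_mul _).const_mul _),
    lintegral_add_right _ ((measurable_ofReal_exp_mul _).const_mul _),
    lintegral_const_mul _ (measurable_ofReal_exp_mul _),
    lintegral_const_mul _ (measurable_ofReal_exp_mul _),
    lintegral_indicator_const measurableSet_ball]

/-- At θ = log(x/λ)/λ the derivative of exp(uλ) is x: this tilt moves the mean to x. The claim is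
the first-order expansion there, with error at most r t. -/
theorem exists_tilt {lam x r : ℝ} (hlam : 0 < lam) (hx : 0 < x) (hr : 0 < r) :
    ∃ t : ℝ, 0 < t ∧ t ≤ 1 ∧ ∀ s : ℝ, |s| = t →
      Real.exp ((Real.log (x / lam) / lam + s) * lam) ≤
        Real.exp (Real.log (x / lam) / lam * lam) + s * x + r * t := by
  set θ := Real.log (x / lam) / lam with hθ
  have hd : HasDerivAt (fun u : ℝ => Real.exp (u * lam)) x θ := by
    have h1 := ((hasDerivAt_id θ).mul_const lam).exp
    have h2 : Real.exp (id θ * lam) * (1 * lam) = x := by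
      rw [id, hθ, div_mul_cancel₀ _ hlam.ne', Real.exp_log (by positivity)]
      field_simp
    rwa [h2] at h1
  have ho := (hasDerivAt_iff_isLittleO_nhds_zero.1 hd).bound hr
  obtain ⟨ρ, hρ, hball⟩ := Metric.eventually_nhds_iff.1 ho
  refine ⟨min 1 (ρ / 2), by positivity, min_le_left _ _, fun s hs => ?_⟩
  have hsρ : dist s 0 < ρ := by
    rw [Real.dist_eq, sub_zero, hs]
    exact (min_le_right _ _).trans_lt (by linarith)
  have := (le_abs_self _).trans (hball hsρ)
  rw [Real.norm_eq_abs, hs, smul_eq_mul] at this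
  linarith

theorem eventually_le_measure_ball (h : HasPoissonExpMoments P b lam)
    (hb : Tendsto b atTop atTop) (hlam : 0 < lam) {x r k : ℝ} (hx : 0 < x) (hr : 0 < r)
    (hk : poissonRateReal lam x < k) :
    ∀ᶠ n in atTop, ENNReal.ofReal (Real.exp (-k * b n)) ≤ P n (Metric.ball x r) := by
  set θ := Real.log (x / lam) / lam with hθ
  have hleg : θ * x - (Real.exp (θ * lam) - 1) = poissonRateReal lam x :=
    mul_sub_exp_eq_poissonRateReal hlam hx
  obtain ⟨ρ, hρ, hρr, hρk⟩ : ∃ ρ : ℝ, 0 < ρ ∧ ρ ≤ r ∧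
      (|θ| + 1) * ρ ≤ k - poissonRateReal lam x := by
    have h1 : 0 < |θ| + 1 := by positivity
    have h2 : 0 < k - poissonRateReal lam x := sub_pos.2 hk
    refine ⟨min r ((k - poissonRateReal lam x) / (|θ| + 1)), by positivity, min_le_left _ _, ?_⟩
    rw [mul_comm, ← le_div_iff₀ h1]
    exact min_le_right _ _
  obtain ⟨t, ht, ht1, htilt⟩ := exists_tilt hlam hx (half_pos hρ)
  set Λ := Real.exp (θ * lam) - 1 with hΛ
  -- Leaving the ball gains ρt, and the tilt expansion loses ρt/2; the net gain 4η pays for the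
  -- slack η in the moments and leaves the exponent Λ - 3η.
  set η := ρ * t / 8 with hη
  have hη0 : 0 < η := by positivity
  filter_upwards [h θ η hη0, h (θ + t) η hη0, h (θ - t) η hη0, hb.eventually_ge_atTop 0,
    eventually_two_mul_ofReal_exp_le hb (show Λ - 3 * η < Λ - 2 * η by linarith),
    eventually_two_mul_ofReal_exp_le hb (show Λ - 2 * η < Λ - η by linarith)]
    with n h0 hp hm hbn h32 h21
  have hplus : ENNReal.ofReal (Real.exp (-(t * (x + ρ)) * b n)) *
      ∫⁻ y, ENNReal.ofReal (Real.exp ((θ + t) * b n * y)) ∂P n ≤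
        ENNReal.ofReal (Real.exp ((Λ - 3 * η) * b n)) := by
    refine (mul_le_mul_right hp.2 _).trans ?_
    rw [ofReal_exp_mul_ofReal_exp, ← add_mul]
    refine ENNReal.ofReal_le_ofReal (Real.exp_le_exp.2 (mul_le_mul_of_nonneg_right ?_ hbn))
    linarith [htilt t (abs_of_pos ht)]
  have hminus : ENNReal.ofReal (Real.exp (t * (x - ρ) * b n)) *
      ∫⁻ y, ENNReal.ofReal (Real.exp ((θ - t) * b n * y)) ∂P n ≤
        ENNReal.ofReal (Real.exp ((Λ - 3 * η) * b n)) := by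
    refine (mul_le_mul_right hm.2 _).trans ?_
    rw [ofReal_exp_mul_ofReal_exp, ← add_mul]
    refine ENNReal.ofReal_le_ofReal (Real.exp_le_exp.2 (mul_le_mul_of_nonneg_right ?_ hbn))
    have := htilt (-t) (by rw [abs_neg, abs_of_pos ht])
    rw [← sub_eq_add_neg] at this
    linarith
  have hsum := (h21.trans h0.1).trans (lintegral_exp_mul_le (P n) (x := x) (r := ρ) hbn ht.le)
  rw [add_assoc] at hsum
  have hmain := ENNReal.le_of_add_le_add_right ENNReal.ofReal_ne_top
    (hsum.trans (add_le_add_right ((add_le_add hplus hminus).trans h32) _))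
  have h2 := mul_le_mul_right hmain (ENNReal.ofReal (Real.exp (-((θ * x + |θ| * ρ) * b n))))
  rw [← mul_assoc, ofReal_exp_mul_ofReal_exp, ofReal_exp_mul_ofReal_exp, neg_add_cancel,
    Real.exp_zero, ENNReal.ofReal_one, one_mul] at h2
  refine le_trans (ENNReal.ofReal_le_ofReal (Real.exp_le_exp.2 ?_))
    (h2.trans (measure_mono (Metric.ball_subset_ball hρr)))
  rw [← neg_mul, ← add_mul]
  refine mul_le_mul_of_nonneg_right ?_ hbn
  -- Since t ≤ 1, 2η = ρt/4 ≤ ρ, so the total loss |θ|ρ + 2η is within the margin reserved by `hρk`.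
  nlinarith

/-- At x = 0 no finite tilt exists, so the point is moved slightly to the right, where continuity
keeps the rate below k. -/
theorem eventually_le_measure_of_mem_interior (h : HasPoissonExpMoments P b lam)
    (hb : Tendsto b atTop atTop) (hlam : 0 < lam) {A : Set ℝ} {x k : ℝ} (hx : 0 ≤ x)
    (hxA : x ∈ interior A) (hk : poissonRateReal lam x < k) :
    ∀ᶠ n in atTop, ENNReal.ofReal (Real.exp (-k * b n)) ≤ P n A := by
  have hev : ∀ᶠ y in 𝓝 x, y ∈ interior A ∧ poissonRateReal lam y < k :=
    (isOpen_interior.eventually_mem hxA).and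
      (((continuous_poissonRateReal lam).tendsto x).eventually_lt_const hk)
  obtain ⟨y, ⟨hyA, hyk⟩, hxy⟩ :=
    ((hev.filter_mono nhdsWithin_le_nhds).and (self_mem_nhdsWithin (s := Set.Ioi x))).exists
  obtain ⟨r, hr, hball⟩ := Metric.isOpen_iff.1 isOpen_interior y hyA
  filter_upwards [h.eventually_le_measure_ball hb hlam (hx.trans_lt hxy) hr hyk] with n hn
  exact hn.trans (measure_mono (hball.trans interior_subset))

theorem coe_inv_mul_log_ofReal_exp {β : ℝ} (hβ : 0 < β) (k : ℝ) :
    ((β⁻¹ : ℝ) : EReal) * ENNReal.log (ENNReal.ofReal (Real.exp (k * β))) = (k : EReal) := by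
  rw [ENNReal.log_ofReal_of_pos (Real.exp_pos _), Real.log_exp, ← EReal.coe_mul]
  congr 1
  field_simp

/-- The Gärtner–Ellis theorem for Poisson exponential moments. -/
theorem satisfiesLDP (h : HasPoissonExpMoments P b lam) (hb : Tendsto b atTop atTop)
    (hlam : 0 < lam) (hP : ∀ᶠ n in atTop, IsProbabilityMeasure (P n)) :
    SatisfiesLDP P b (poissonRate lam) where
  isProbabilityMeasure := hP
  nonneg := poissonRate_nonneg hlam
  lowerSemicontinuous := lowerSemicontinuous_poissonRate lam
  lower_bound A _ := by
    rw [EReal.neg_le]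
    refine le_iInf₂ fun x hxA => ?_
    rcases lt_or_ge x 0 with hx | hx
    · rw [poissonRate_of_neg lam hx]; exact le_top
    rw [poissonRate_of_nonneg lam hx, ← EReal.le_of_forall_lt_iff_le]
    intro k hk
    rw [EReal.neg_le, ← EReal.coe_neg]
    refine le_liminf_of_le (by isBoundedDefault) ?_
    filter_upwards [h.eventually_le_measure_of_mem_interior hb hlam hx hxA
      (EReal.coe_lt_coe_iff.1 hk), hb.eventually_gt_atTop 0] with n hn hbn
    rw [← coe_inv_mul_log_ofReal_exp hbn (-k)]
    exact mul_le_mul_of_nonneg_left (ENNReal.log_monotone hn)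
      (EReal.coe_nonneg.2 (inv_nonneg.2 hbn.le))
  upper_bound A _ := by
    rw [EReal.le_neg, ← EReal.ge_of_forall_gt_iff_ge]
    intro c hc
    rw [EReal.le_neg, ← EReal.coe_neg]
    refine limsup_le_of_le (by isBoundedDefault) ?_
    filter_upwards [h.eventually_measure_closed_le hb hlam isClosed_closure
      (fun x hx => hc.trans_le (iInf₂_le x hx)), hb.eventually_gt_atTop 0] with n hn hbn
    rw [← coe_inv_mul_log_ofReal_exp hbn (-c)]
    exact mul_le_mul_of_nonneg_left
      (ENNReal.log_monotone ((measure_mono subset_closure).trans hn))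
      (EReal.coe_nonneg.2 (inv_nonneg.2 hbn.le))

end HasPoissonExpMoments

/-! ### Application to the laws of X(n) / log log n and to ω. -/

theorem isProbabilityMeasure_scaledLaw (g : ℕ → ℝ) {n : ℕ} (hn : 0 < n) :
    IsProbabilityMeasure (scaledLaw g n) := by
  have := ProbabilityTheory.isProbabilityMeasure_uniformOn (Set.finite_Icc 1 n)
    (Set.nonempty_Icc.2 hn)
  exact Measure.isProbabilityMeasure_map (Measurable.of_discrete).aemeasurable

theorem lintegral_scaledLaw (g : ℕ → ℝ) (n : ℕ) {φ : ℝ → ENNReal} (hφ : Measurable φ) :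
    ∫⁻ x, φ x ∂scaledLaw g n = (n : ENNReal)⁻¹ * ∑ m ∈ Finset.Icc 1 n, φ (g m / logLog n) := by
  rw [scaledLaw, lintegral_map hφ Measurable.of_discrete, ProbabilityTheory.uniformOn,
    ProbabilityTheory.cond, lintegral_smul_measure, ← Finset.coe_Icc, lintegral_finset,
    Measure.count_apply_finset]
  simp

theorem hasPoissonExpMoments_scaledLaw {g : ℕ → ℝ} {lam : ℝ} (hg : IsStronglyAdditive g)
    (hlam : 0 < lam) (hlim : Tendsto g (atTop ⊓ 𝓟 {p : ℕ | p.Prime}) (𝓝 lam)) :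
    HasPoissonExpMoments (scaledLaw g) logLog lam := by
  intro θ δ hδ
  filter_upwards [eventually_mgf_le hg hlam hlim θ hδ, eventually_le_mgf hg hlam hlim θ hδ,
    tendsto_logLog_atTop.eventually_gt_atTop 0, eventually_gt_atTop 0] with n hle hge hL hn
  have hn' : (0 : ℝ) < n := by exact_mod_cast hn
  have hint : ∫⁻ x, ENNReal.ofReal (Real.exp (θ * logLog n * x)) ∂scaledLaw g n =
      ENNReal.ofReal ((n : ℝ)⁻¹ * ∑ m ∈ Finset.Icc 1 n, Real.exp (θ * g m)) := by
    rw [lintegral_scaledLaw g n (measurable_ofReal_exp_mul _), ENNReal.ofReal_mul (by positivity),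
      ENNReal.ofReal_inv_of_pos hn', ENNReal.ofReal_natCast,
      ENNReal.ofReal_sum_of_nonneg fun _ _ => (Real.exp_pos _).le]
    congr 1
    refine Finset.sum_congr rfl fun m _ => ?_
    congr 2
    field_simp
  rw [hint]
  constructor <;> refine ENNReal.ofReal_le_ofReal ?_
  · rwa [le_inv_mul_iff₀ hn']
  · rwa [inv_mul_le_iff₀ hn']

/-- The large deviation principle for strongly additive functions with a positive limit along the
primes. -/
theorem IsStronglyAdditive.satisfiesLDP {g : ℕ → ℝ} {lam : ℝ} (hg : IsStronglyAdditive g)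
    (hlam : 0 < lam) (hlim : Tendsto g (atTop ⊓ 𝓟 {p : ℕ | p.Prime}) (𝓝 lam)) :
    SatisfiesLDP (scaledLaw g) logLog (poissonRate lam) := by
  refine (hasPoissonExpMoments_scaledLaw hg hlam hlim).satisfiesLDP tendsto_logLog_atTop hlam ?_
  filter_upwards [eventually_gt_atTop 0] with n hn
  exact isProbabilityMeasure_scaledLaw g hn

theorem poissonRate_one : poissonRate 1 = standardPoissonRate := by
  ext x
  rw [poissonRate, standardPoissonRate, div_one]

theorem isStronglyAdditive_cardDistinctFactors :
    IsStronglyAdditive fun m => (ArithmeticFunction.cardDistinctFactors m : ℝ) where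
  map_prime_pow p k hp hk := by
    rw [ArithmeticFunction.cardDistinctFactors_apply_prime_pow hp (by omega),
      ArithmeticFunction.cardDistinctFactors_apply_prime hp]
  map_mul m n h := by
    rw [ArithmeticFunction.cardDistinctFactors_mul h, Nat.cast_add]

theorem IsStronglyAdditive.satisfiesLDP_of_prime_eq_one {g : ℕ → ℝ} (hg : IsStronglyAdditive g)
    (h1 : ∀ p : ℕ, p.Prime → g p = 1) :
    SatisfiesLDP (scaledLaw g) logLog standardPoissonRate := by
  rw [← poissonRate_one]
  refine hg.satisfiesLDP one_pos (tendsto_const_nhds.congr' ?_)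
  exact eventually_inf_principal.2 (Eventually.of_forall fun p hp => (h1 p hp).symm)

theorem mainTheorem2 :
    (∀ (g : ℕ → ℝ) (lam : ℝ), IsStronglyAdditive g → 0 < lam →
      Tendsto g (atTop ⊓ 𝓟 {p : ℕ | p.Prime}) (𝓝 lam) →
      SatisfiesLDP (scaledLaw g) (fun n => Real.log (Real.log (n : ℝ))) (poissonRate lam)) ∧
    (∀ g : ℕ → ℝ, IsStronglyAdditive g → (∀ p : ℕ, p.Prime → g p = 1) →
      (∀ m : ℕ, 1 ≤ m → g m = (ArithmeticFunction.cardDistinctFactors m : ℝ)) ∧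
      SatisfiesLDP (scaledLaw g) (fun n => Real.log (Real.log (n : ℝ))) standardPoissonRate) ∧
    SatisfiesLDP (scaledLaw fun m => (ArithmeticFunction.cardDistinctFactors m : ℝ))
      (fun n => Real.log (Real.log (n : ℝ))) standardPoissonRate := by
  refine ⟨fun g lam hg hlam hlim => hg.satisfiesLDP hlam hlim, fun g hg h1 =>
    ⟨fun m hm => ?_, hg.satisfiesLDP_of_prime_eq_one h1⟩,
    isStronglyAdditive_cardDistinctFactors.satisfiesLDP_of_prime_eq_one fun p hp => by
      rw [ArithmeticFunction.cardDistinctFactors_apply_prime hp, Nat.cast_one]⟩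
  have hm0 : m ≠ 0 := by omega
  rw [hg.eq_sum_primeFactors hm0, isStronglyAdditive_cardDistinctFactors.eq_sum_primeFactors hm0]
  refine Finset.sum_congr rfl fun p hp => ?_
  have hp' := Nat.prime_of_mem_primeFactors hp
  rw [h1 p hp', ArithmeticFunction.cardDistinctFactors_apply_prime hp', Nat.cast_one]
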